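/- ProbNetKAT. Fix finitely many fields $f_1,\dots,f_k$, each ranging over a finite initial segment of $\mathbb N$. A packet $\pi$ assigns a value to each field; a history $\pi{::}\hbar$ is a non-empty finite list of packets with head $\pi$; $H$ is the countable set of histories. Predicates $t$ and programs $p$ are given by $$t,u ::= \mathsf{drop}\mid \mathsf{skip}\mid f=n\mid t\,\&\,u\mid t;u\mid \neg t,\qquad p,q ::= t\mid f\leftarrow n\mid \mathsf{dup}\mid p\,\&\,q\mid p;q\mid p\oplus_r q\mid p^*\quad(r\in[0,1]).$$ Give $2^H$ the order $\subseteq$ and the $\sigma$-algebra generated by the sets $\{c : h\in c\}$, $h\in H$ (the Borel sets of the Cantor topology, equivalently of the Scott topology). Let $\mathcal M(2^H)$ be the set of probability measures on $2^H$, ordered by $\mu\sqsubseteq\nu$ iff $\mu(B)\le\nu(B)$ for all Scott-open $B$, and write $\delta_a$ for the Dirac measure and $(\mu \gg\!\!= P)(A)=\int P(a)(A)\,\mu(da)$. The semantics $[\![p]\!]:2^H\to\mathcal M(2^H)$ is defined by $$\begin{aligned} [\![\mathsf{drop}]\!](a)&=\delta_\emptyset,\qquad [\![\mathsf{skip}]\!](a)=\delta_a,\qquad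 [\![f=n]\!](a)=\delta_{\{\pi::\hbar\in a\,:\,\pi.f=n\}},\\ [\![\neg t]\!](a)&=[\![t]\!](a)\gg\!\!=\lambda b.\,\delta_{a\setminus b},\qquad [\![f\leftarrow n]\!](a)=\delta_{\{\pi[f:=n]::\hbar\,:\,\pi::\hbar\in a\}},\\ [\![\mathsf{dup}]\!](a)&=\delta_{\{\pi::\pi::\hbar\,:\,\pi::\hbar\in a\}},\qquad [\![p\,\&\,q]\!](a)=[\![p]\!](a)\gg\!\!=\lambda b_1.\,[\![q]\!](a)\gg\!\!=\lambda b_2.\,\delta_{b_1\cup b_2},\\ [\![p;q]\!](a)&=[\![p]\!](a)\gg\!\!=[\![q]\!],\qquad [\![p\oplus_r q]\!](a)=r\,[\![p]\!](a)+(1-r)\,[\![q]\!](a),\\ [\![p^*]\!](a)&=\bigsqcup_{n\ge 0}[\![p^{(n)}]\!](a)\ \text{ (supremum in }(\mathcal M(2^H),\sqsubseteq)),\quad p^{(0)}=\mathsf{skip},\quad p^{(n+1)}=\mathsf{skip}\,\&\,(p;p^{(n)}). \end{aligned}$$ For $n\in\mathbb N$ the $n$-th approximant $[p]_n$ of $p$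 replaces every iteration by a bounded one: $[p]_n=p$ for predicates, modifications and $\mathsf{dup}$; $[\cdot]_n$ commutes with $\&$, $;$ and $\oplus_r$; and $[q^*]_n=([q]_n)^{(n)}$. Put $[\![p]\!]_n=[\![[p]_n]\!]$. **Corollary.** Let $\mu$ be a probability measure on $2^H$, $p$ a program and $Q:2^H\to[0,\infty]$ Scott-continuous (monotone and preserving directed suprema). Put $\nu=\mu\gg\!\!=[\![p]\!]$ and $\nu_n=\mu\gg\!\!=[\![p]\!]_n$ for $n\ge 0$. Then $\nu$ and all $\nu_n$ are well-defined probability measures, $$\int Q\,d\nu_0\le\int Q\,d\nu_1\le\int Q\,d\nu_2\le\cdots\qquad\text{and}\qquad \sup_{n\in\mathbb N}\int Q\,d\nu_n=\int Q\,d\nu .$$ -/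

import Mathlib

open MeasureTheory
open scoped ENNReal Topology

noncomputable section

namespace ProbNetKAT

/-! ### Packets and histories -/

/-- A packet is a record which assigns to each of the fields `f₁, …, f_k` a bounded natural number:
the values of the field `f` are `0, …, bound f - 1`. -/
abbrev Packet {k : ℕ} (bound : Fin k → ℕ) : Type := (f : Fin k) → Fin (bound f)

/-- A history is a non-empty list of packets, with a head packet and a (possibly empty) tail. -/
@[ext] structure History {k : ℕ} (bound : Fin k → ℕ) : Type where
  head : Packet bound
  tail : List (Packet bound)

/-! ### Syntax -/

/-- Predicates. -/
inductive Pred {k : ℕ} (bound : Fin k → ℕ) : Type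
  | drop : Pred bound
  | skip : Pred bound
  | test (f : Fin k) (n : Fin (bound f)) : Pred bound
  | disj (t u : Pred bound) : Pred bound
  | conj (t u : Pred bound) : Pred bound
  | neg (t : Pred bound) : Pred bound

/-- Programs. `choice r p q` runs `p` with probability `r` and `q` with probability `1 - r`. -/
inductive Prog {k : ℕ} (bound : Fin k → ℕ) : Type
  | filter (t : Pred bound) : Prog bound
  | modify (f : Fin k) (n : Fin (bound f)) : Prog bound
  | dup : Prog bound
  | par (p q : Prog bound) : Prog bound
  | seq (p q : Prog bound) : Prog bound
  | choice (r : unitInterval) (p q : Prog bound) : Prog bound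
  | star (p : Prog bound) : Prog bound

/-- Bounded iteration: `p⁽⁰⁾ = skip` and `p⁽ⁿ⁺¹⁾ = skip & p ; p⁽ⁿ⁾`. -/
def Prog.iter {k : ℕ} {bound : Fin k → ℕ} (p : Prog bound) : ℕ → Prog bound
  | 0 => .filter .skip
  | n + 1 => .par (.filter .skip) (.seq p (p.iter n))

/-- The `n`-th approximant `[p]ₙ`: every iteration is replaced by a bounded iteration. -/
def Prog.approx {k : ℕ} {bound : Fin k → ℕ} : Prog bound → ℕ → Prog bound
  | .filter t, _ => .filter t
  | .modify f m, _ => .modify f m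
  | .dup, _ => .dup
  | .par p q, n => .par (p.approx n) (q.approx n)
  | .seq p q, n => .seq (p.approx n) (q.approx n)
  | .choice r p q, n => .choice r (p.approx n) (q.approx n)
  | .star p, n => (p.approx n).iter n

/-! ### Measures on a powerset

A powerset `Set α` is ordered by inclusion and carries Mathlib's σ-algebra, the one generated by the
sets `{c | h ∈ c}`. For countable `α` this is the Borel σ-algebra of the Cantor topology. -/

/-- The Cantor topology on a powerset, generated by the sets `{c | h ∈ c}` and their complements. -/
@[reducible] def cantorTopology (α : Type*) : TopologicalSpace (Set α) :=
  TopologicalSpace.generateFrom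
    (Set.range (fun h : α => {c : Set α | h ∈ c}) ∪ Set.range (fun h : α => {c : Set α | h ∈ c}ᶜ))

theorem measurableSpace_eq_borel_cantor (α : Type*) [Countable α] :
    (Set.instMeasurableSpace : MeasurableSpace (Set α)) = @borel (Set α) (cantorTopology α) := by
  have hsc : @SecondCountableTopology (Set α) (cantorTopology α) :=
    @SecondCountableTopology.mk _ (cantorTopology α)
      ⟨_, (Set.countable_range _).union (Set.countable_range _), rfl⟩
  rw [@borel_eq_generateFrom_of_subbasis _ _ (cantorTopology α) hsc rfl]
  apply le_antisymm
  · let m : MeasurableSpace (Set α) := MeasurableSpace.generateFrom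
      (Set.range (fun h : α => {c : Set α | h ∈ c}) ∪ Set.range (fun h : α => {c : Set α | h ∈ c}ᶜ))
    have hid : @Measurable (Set α) (Set α) m Set.instMeasurableSpace id := by
      refine (@measurable_set_iff α (Set α) m id).2 fun h => ?_
      refine (@measurableSet_setOfPred (Set α) m _).1 ?_
      exact MeasurableSpace.measurableSet_generateFrom (Or.inl ⟨h, rfl⟩)
    intro s hs
    exact hid hs
  · refine MeasurableSpace.generateFrom_le ?_
    rintro _ (⟨h, rfl⟩ | ⟨h, rfl⟩)
    · exact measurableSet_mem h
    · exact (measurableSet_mem h).compl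

/-- The order `μ ⊑ ν` on measures on a powerset: `μ(B) ≤ ν(B)` for all Scott-open `B`. -/
def ScottLE {α : Type*} (μ ν : Measure (Set α)) : Prop :=
  ∀ B : Set (Set α), IsOpen[Topology.scott (Set α) Set.univ] B → μ B ≤ ν B

/-- `ν` is a supremum of `S` in the set of probability measures on the powerset, ordered by `⊑`. -/
structure IsScottSup {α : Type*} (S : Set (Measure (Set α))) (ν : Measure (Set α)) : Prop where
  isProbabilityMeasure : IsProbabilityMeasure ν
  upper : ∀ μ ∈ S, ScottLE μ ν
  least : ∀ ρ : Measure (Set α), IsProbabilityMeasure ρ → (∀ μ ∈ S, ScottLE μ ρ) → ScottLE ν ρ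

open scoped Classical in
/-- The supremum `⨆ S` in the set of probability measures ordered by `⊑`
(by convention the zero measure if there is none). -/
def scottSup {α : Type*} (S : Set (Measure (Set α))) : Measure (Set α) :=
  if h : ∃ ν, IsScottSup S ν then h.choose else 0

/-! ### Operators on functions `2^α → M(2^α)` -/

/-- Parallel composition. -/
def parK {α : Type*} (P Q : Set α → Measure (Set α)) (a : Set α) : Measure (Set α) :=
  (P a).bind fun b₁ => (Q a).bind fun b₂ => Measure.dirac (b₁ ∪ b₂)

/-- Sequential composition. -/
def seqK {α : Type*} (P Q : Set α → Measure (Set α)) (a : Set α) : Measure (Set α) :=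
  (P a).bind Q

/-- Probabilistic choice. -/
def choiceK {α : Type*} (r : unitInterval) (P Q : Set α → Measure (Set α)) (a : Set α) :
    Measure (Set α) :=
  ENNReal.ofReal (r : ℝ) • P a + ENNReal.ofReal (1 - (r : ℝ)) • Q a

/-- Bounded iteration `P⁽ⁿ⁾`. -/
def iterK {α : Type*} (P : Set α → Measure (Set α)) : ℕ → Set α → Measure (Set α)
  | 0 => fun a => Measure.dirac a
  | n + 1 => parK (fun a => Measure.dirac a) (seqK P (iterK P n))

/-- Iteration `P* = ⨆ₙ P⁽ⁿ⁾`. -/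
def starK {α : Type*} (P : Set α → Measure (Set α)) (a : Set α) : Measure (Set α) :=
  scottSup (Set.range fun n : ℕ => iterK P n a)

/-! ### Semantics -/

/-- The semantics of predicates. -/
def Pred.den {k : ℕ} {bound : Fin k → ℕ} :
    Pred bound → Set (History bound) → Measure (Set (History bound))
  | .drop => fun _ => Measure.dirac ∅
  | .skip => fun a => Measure.dirac a
  | .test f n => fun a => Measure.dirac {h ∈ a | h.head f = n}
  | .disj t u => parK t.den u.den
  | .conj t u => seqK t.den u.den
  | .neg t => fun a => (t.den a).bind fun b => Measure.dirac (a \ b)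

/-- The semantics `⟦p⟧` of programs. -/
def Prog.den {k : ℕ} {bound : Fin k → ℕ} :
    Prog bound → Set (History bound) → Measure (Set (History bound))
  | .filter t => t.den
  | .modify f n => fun a =>
      Measure.dirac ((fun h : History bound => ⟨Function.update h.head f n, h.tail⟩) '' a)
  | .dup => fun a =>
      Measure.dirac ((fun h : History bound => ⟨h.head, h.head :: h.tail⟩) '' a)
  | .par p q => parK p.den q.den
  | .seq p q => seqK p.den q.den
  | .choice r p q => choiceK r p.den q.den
  | .star p => starK p.den

/-- The operator `P⁽ⁿ⁾` used in the semantics of iteration is the semantics of the program `p⁽ⁿ⁾`. -/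
theorem Prog.den_iter {k : ℕ} {bound : Fin k → ℕ} (p : Prog bound) (n : ℕ) :
    (p.iter n).den = iterK p.den n := by
  induction n with
  | zero => rfl
  | succ n ih => simp only [Prog.iter, Prog.den, Pred.den, iterK, ih]

theorem Prog.den_star {k : ℕ} {bound : Fin k → ℕ} (p : Prog bound) (a : Set (History bound)) :
    p.star.den a = scottSup (Set.range fun n : ℕ => (p.iter n).den a) := by
  simp only [Prog.den_iter]
  rfl

end ProbNetKAT

end

open MeasureTheory
open scoped ENNReal Topology

namespace ProbNetKAT

variable {α : Type*}

/-! ### ω-continuous functions on a powerset -/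

/-! Measures are tested against ω-continuous functions: `ScottLim μ ν` says that the integrals of
every such `Q` increase along `μ` with supremum the integral against `ν`. The theorem follows from
`Prog.scottLim_approx`, the convergence of the approximants at each input, by binding with the
constant sequence at the initial measure (`ScottLim.bind`).

The convergence is proved by induction on the program. The induction needs every denotation to be a
Scott kernel (`Prog.isScottKernel_den`): then integrating `Q` against it gives an ω-continuous
function of the input, in particular a measurable one, so composites are meaningful and can be
tested again. Each limit of a composite is the diagonal of a doubly increasing family, where suprema
commute. For iteration the family is the `m`-fold iterate of the `n`-th approximant, and its
diagonal is the approximant of the star.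

The supremum defining the star exists by compactness of the space of probability measures on the
Cantor space (`exists_limit`). Countability lets sequences replace directed sets, since every set of
histories is an increasing union of finite sets. -/

/-- Monotone functions which preserve suprema of increasing sequences. -/
structure OmegaCont (Q : Set α → ℝ≥0∞) : Prop where
  mono : Monotone Q
  map_iUnion : ∀ s : ℕ → Set α, Monotone s → Q (⋃ n, s n) = ⨆ n, Q (s n)

theorem OmegaCont.of_scottContinuous {Q : Set α → ℝ≥0∞} (hQ : ScottContinuous Q) :
    OmegaCont Q := by
  refine ⟨hQ.monotone, fun s hs => ?_⟩
  have h := hQ (Set.range_nonempty s) (directedOn_range.2 hs.directed_le)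
    (a := ⋃ n, s n) (isLUB_iSup (f := s))
  rw [← Set.range_comp] at h
  exact h.unique isLUB_iSup

/-- The sets which contain a member of a family of finite sets. -/
def gen (𝓕 : Set (Finset α)) : Set (Set α) := {c | ∃ F ∈ 𝓕, (F : Set α) ⊆ c}

theorem exists_subset_of_subset_iUnion (F : Finset α) {s : ℕ → Set α} (hs : Monotone s)
    (hF : (F : Set α) ⊆ ⋃ n, s n) : ∃ n, (F : Set α) ⊆ s n :=
  DirectedOn.exists_mem_subset_of_finset_subset_biUnion (c := Set.univ) (f := s)
    Set.univ_nonempty (fun i _ j _ => ⟨max i j, trivial, hs (le_max_left _ _),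
      hs (le_max_right _ _)⟩) (by simpa using hF) |>.imp fun _ h => h.2

theorem exists_finset_chain [Countable α] (c : Set α) :
    ∃ F : ℕ → Finset α, Monotone (fun n => (F n : Set α)) ∧ ⋃ n, (F n : Set α) = c := by
  obtain ⟨e, he⟩ := exists_injective_nat α
  have hfin (n : ℕ) : {x | x ∈ c ∧ e x ≤ n}.Finite :=
    ((Set.finite_Iic n).preimage he.injOn).subset fun x hx => hx.2
  refine ⟨fun n => (hfin n).toFinset, fun m n hmn x => ?_, ?_⟩
  · simpa using fun h1 h2 => ⟨h1, h2.trans hmn⟩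
  · ext x
    simpa using fun _ => ⟨e x, le_rfl⟩

theorem measurableSet_up (F : Finset α) : MeasurableSet {c : Set α | (F : Set α) ⊆ c} := by
  have : {c : Set α | (F : Set α) ⊆ c} = ⋂ x ∈ F, {c : Set α | x ∈ c} := by
    ext c
    simp [Set.subset_def]
  rw [this]
  exact F.measurableSet_biInter fun x _ => measurableSet_mem x

theorem gen_eq_iUnion (𝓕 : Set (Finset α)) :
    gen 𝓕 = ⋃ F ∈ 𝓕, {c : Set α | (F : Set α) ⊆ c} := by
  ext c
  simp [gen]

theorem measurableSet_gen [Countable α] (𝓕 : Set (Finset α)) : MeasurableSet (gen 𝓕) := by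
  rw [gen_eq_iUnion]
  exact MeasurableSet.biUnion (Set.to_countable _) fun F _ => measurableSet_up F

theorem gen_singleton (F : Finset α) : gen {F} = {c | (F : Set α) ⊆ c} := by simp [gen]

theorem omegaCont_indicator_gen (𝓕 : Set (Finset α)) :
    OmegaCont ((gen 𝓕).indicator fun _ => (1 : ℝ≥0∞)) := by
  classical
  have hm : Monotone ((gen 𝓕).indicator fun _ => (1 : ℝ≥0∞)) := by
    intro a b hab
    by_cases ha : a ∈ gen 𝓕
    · have hb : b ∈ gen 𝓕 := ha.imp fun F h => ⟨h.1, h.2.trans hab⟩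
      simp [ha, hb]
    · simp [ha]
  refine ⟨hm, fun s hs => le_antisymm ?_ (iSup_le fun n => hm (Set.subset_iUnion s n))⟩
  by_cases h : (⋃ n, s n) ∈ gen 𝓕
  · obtain ⟨F, hF, hFs⟩ := h
    obtain ⟨n, hn⟩ := exists_subset_of_subset_iUnion F hs hFs
    refine le_iSup_of_le n ?_
    rw [Set.indicator_of_mem (show s n ∈ gen 𝓕 from ⟨F, hF, hn⟩)]
    exact Set.indicator_le_self _ _ _
  · simp [h]

/-- Since `c` is an increasing union of finite sets, exceeding `t` at `c` is already witnessed by a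
finite subset. -/
theorem OmegaCont.setOf_lt_eq_gen [Countable α] {Q : Set α → ℝ≥0∞} (hQ : OmegaCont Q)
    (t : ℝ≥0∞) : {c | t < Q c} = gen {F : Finset α | t < Q F} := by
  ext c
  constructor
  · intro hc
    obtain ⟨F, hF, rfl⟩ := exists_finset_chain c
    rw [Set.mem_ofPred_eq, hQ.map_iUnion _ hF] at hc
    obtain ⟨n, hn⟩ := lt_iSup_iff.1 hc
    exact ⟨F n, hn, Set.subset_iUnion (fun n => (F n : Set α)) n⟩
  · rintro ⟨F, hF, hFc⟩
    exact lt_of_lt_of_le hF (hQ.mono hFc)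

theorem OmegaCont.measurable [Countable α] {Q : Set α → ℝ≥0∞} (hQ : OmegaCont Q) :
    Measurable Q :=
  measurable_of_Ioi fun t => by
    have := measurableSet_gen {F : Finset α | t < Q F}
    rwa [← hQ.setOf_lt_eq_gen] at this

theorem isOpen_gen (𝓕 : Set (Finset α)) :
    IsOpen[Topology.scott (Set α) Set.univ] (gen 𝓕) := by
  let := Topology.scott (Set α) Set.univ
  have : Topology.IsScott (Set α) Set.univ := ⟨rfl⟩
  rw [Topology.IsScott.isOpen_iff_isUpperSet_and_dirSupInaccOn (D := Set.univ)]
  refine ⟨fun a b hab ha => ha.imp fun F h => ⟨h.1, h.2.trans hab⟩, ?_⟩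
  rintro d - hne hd a ha ⟨F, hF, hFa⟩
  rw [← ha.sSup_eq, Set.sSup_eq_sUnion] at hFa
  obtain ⟨b, hb, hFb⟩ := DirectedOn.exists_mem_subset_of_finset_subset_biUnion (c := d)
    (f := id) hne (fun i hi j hj => hd i hi j hj) (by simpa [Set.sUnion_eq_biUnion] using hFa)
  exact ⟨b, hb, F, hF, hFb⟩

/-- With `isOpen_gen`, this identifies the Scott-open sets with the sets `gen 𝓕`, so that `⊑` can be
checked on the latter. -/
theorem exists_eq_gen_of_isOpen [Countable α] {B : Set (Set α)}
    (hB : IsOpen[Topology.scott (Set α) Set.univ] B) : ∃ 𝓕, B = gen 𝓕 := by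
  let := Topology.scott (Set α) Set.univ
  have : Topology.IsScott (Set α) Set.univ := ⟨rfl⟩
  rw [Topology.IsScott.isOpen_iff_isUpperSet_and_dirSupInaccOn (D := Set.univ)] at hB
  refine ⟨{F | (F : Set α) ∈ B}, Set.Subset.antisymm (fun c hc => ?_) ?_⟩
  · obtain ⟨F, hF, rfl⟩ := exists_finset_chain c
    obtain ⟨_, ⟨n, rfl⟩, hn⟩ := hB.2 (Set.mem_univ (Set.range fun n => (F n : Set α)))
      (Set.range_nonempty _) (directedOn_range.2 hF.directed_le) isLUB_iSup hc
    exact ⟨F n, hn, Set.subset_iUnion (fun n => (F n : Set α)) n⟩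
  · rintro c ⟨F, hF, hFc⟩
    exact hB.1 hFc hF

/-! ### Limits of increasing sequences of measures -/

/-- `ν` is the limit of the sequence `μ`, which increases on ω-continuous functions. -/
def ScottLim (μ : ℕ → Measure (Set α)) (ν : Measure (Set α)) : Prop :=
  ∀ Q : Set α → ℝ≥0∞, OmegaCont Q →
    Monotone (fun n => ∫⁻ c, Q c ∂μ n) ∧ ⨆ n, ∫⁻ c, Q c ∂μ n = ∫⁻ c, Q c ∂ν

theorem ScottLim.const (ν : Measure (Set α)) : ScottLim (fun _ => ν) ν :=
  fun _ _ => ⟨monotone_const, iSup_const⟩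

theorem lintegral_indicator_lt (x : ℝ≥0∞) :
    ∫⁻ t in Set.Ioi (0 : ℝ), {t : ℝ | ENNReal.ofReal t < x}.indicator 1 t = x := by
  have hm : MeasurableSet {t : ℝ | ENNReal.ofReal t < x} :=
    measurableSet_lt ENNReal.measurable_ofReal measurable_const
  rw [lintegral_indicator_one hm, Measure.restrict_apply hm]
  induction x with
  | top => simp
  | coe x =>
    have : {t : ℝ | ENNReal.ofReal t < x} ∩ Set.Ioi 0 = Set.Ioo 0 (x : ℝ) := by
      ext t
      simp only [Set.mem_inter_iff, Set.mem_ofPred_eq, Set.mem_Ioi, Set.mem_Ioo]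
      rw [and_comm]
      refine and_congr_right fun ht => ?_
      rw [← ENNReal.ofReal_coe_nnreal, ENNReal.ofReal_lt_ofReal_iff_of_nonneg ht.le]
    rw [this]
    simp

/-- Layer-cake formula for functions that may take the value `∞`: Tonelli applied to the region
below the graph. -/
theorem lintegral_eq_lintegral_Ioi {β : Type*} [MeasurableSpace β] (μ : Measure β) [SFinite μ]
    {Q : β → ℝ≥0∞} (hQ : Measurable Q) :
    ∫⁻ c, Q c ∂μ = ∫⁻ t in Set.Ioi (0 : ℝ), μ {c | ENNReal.ofReal t < Q c} := by
  have hm : MeasurableSet {z : β × ℝ | ENNReal.ofReal z.2 < Q z.1} :=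
    measurableSet_lt (ENNReal.measurable_ofReal.comp measurable_snd) (hQ.comp measurable_fst)
  calc
    ∫⁻ c, Q c ∂μ = ∫⁻ c, (∫⁻ t in Set.Ioi (0 : ℝ),
        {z : β × ℝ | ENNReal.ofReal z.2 < Q z.1}.indicator 1 (c, t)) ∂μ :=
      lintegral_congr fun c => (lintegral_indicator_lt (Q c)).symm
    _ = ∫⁻ t in Set.Ioi (0 : ℝ), ∫⁻ c,
        {z : β × ℝ | ENNReal.ofReal z.2 < Q z.1}.indicator 1 (c, t) ∂μ :=
      lintegral_lintegral_swap (measurable_one.indicator hm).aemeasurable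
    _ = _ := by
      refine lintegral_congr fun t => ?_
      exact lintegral_indicator_one (s := {c | ENNReal.ofReal t < Q c})
        (measurableSet_lt measurable_const hQ)

/-- By the layer-cake formula it suffices to treat superlevel sets, which have the form `gen 𝓕`;
monotone convergence in the level `t` then handles the integrals. -/
theorem ScottLim.of_gen [Countable α] {μ : ℕ → Measure (Set α)} {ν : Measure (Set α)}
    [∀ n, IsProbabilityMeasure (μ n)] [IsProbabilityMeasure ν]
    (h : ∀ 𝓕 : Set (Finset α), Monotone (fun n => μ n (gen 𝓕)) ∧
      ⨆ n, μ n (gen 𝓕) = ν (gen 𝓕)) : ScottLim μ ν := by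
  intro Q hQ
  have hlt (t : ℝ) := hQ.setOf_lt_eq_gen (ENNReal.ofReal t)
  simp only [fun n => lintegral_eq_lintegral_Ioi (μ n) hQ.measurable,
    lintegral_eq_lintegral_Ioi ν hQ.measurable]
  refine ⟨fun m n hmn => lintegral_mono fun t => ?_, ?_⟩
  · simp only [hlt]
    exact (h _).1 hmn
  · rw [← lintegral_iSup]
    · refine lintegral_congr fun t => ?_
      simp only [hlt]
      exact (h _).2
    -- Measurability in the level is automatic: the superlevel sets shrink as `t` grows.
    · intro n
      refine Antitone.measurable fun s t hst => measure_mono fun c hc => ?_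
      exact lt_of_le_of_lt (ENNReal.ofReal_le_ofReal hst) hc
    · intro m n hmn t
      simp only [hlt]
      exact (h _).1 hmn

/-- Continuity from below along finite subfamilies, and an exchange of suprema. Finite families
matter because they give clopen sets in the Cantor topology. -/
theorem iSup_measure_gen_of_finite [Countable α] {μ : ℕ → Measure (Set α)} {ν : Measure (Set α)}
    (h : ∀ 𝓕 : Set (Finset α), 𝓕.Finite → ⨆ n, μ n (gen 𝓕) = ν (gen 𝓕))
    (𝓕 : Set (Finset α)) : ⨆ n, μ n (gen 𝓕) = ν (gen 𝓕) := by
  obtain ⟨G, hG, rfl⟩ := exists_finset_chain 𝓕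
  have heq : gen (⋃ i, (G i : Set (Finset α))) = ⋃ i, gen (G i : Set (Finset α)) := by
    ext c
    simp only [gen, Set.mem_ofPred_eq, Set.mem_iUnion]
    grind
  have hmono : Monotone fun i => gen (G i : Set (Finset α)) :=
    fun i j hij c hc => hc.imp fun F hF => ⟨hG hij hF.1, hF.2⟩
  simp only [heq, hmono.measure_iUnion]
  rw [iSup_comm]
  exact iSup_congr fun i => h _ (G i).finite_toSet

/-! ### Existence of limits -/

theorem measurable_setOf_bool : Measurable fun x : α → Bool => {h | x h = true} :=
  measurable_set_iff.2 fun h =>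
    (measurable_of_countable fun b : Bool => b = true).comp (measurable_pi_apply h)

theorem isClopen_bool_up (F : Finset α) :
    IsClopen {x : α → Bool | (F : Set α) ⊆ {h | x h = true}} := by
  have : {x : α → Bool | (F : Set α) ⊆ {h | x h = true}} =
      ⋂ h ∈ F, (fun x : α → Bool => x h) ⁻¹' {true} := by
    ext x
    simp [Set.subset_def]
  rw [this]
  exact isClopen_biInter_finset fun h _ => (isClopen_discrete _).preimage (continuous_apply h)

/-- Compactness yields a weak limit of the measures on `α → Bool` along a free ultrafilter. Weak
convergence is exact on clopen sets, and there the ultrafilter limit of an increasing sequence is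
its supremum. -/
theorem exists_limit [Countable α] (μ : ℕ → Measure (Set α)) [∀ n, IsProbabilityMeasure (μ n)]
    (hmono : ∀ 𝓕 : Set (Finset α), Monotone (fun n => μ n (gen 𝓕))) :
    ∃ ν : Measure (Set α), IsProbabilityMeasure ν ∧
      ∀ 𝓕 : Set (Finset α), ⨆ n, μ n (gen 𝓕) = ν (gen 𝓕) := by
  classical
  have he : Measurable fun c : Set α => fun h => decide (h ∈ c) :=
    measurable_pi_lambda _ fun h =>
      (measurable_of_countable fun p : Prop => decide p).comp (measurable_set_mem h)
  let e : Set α → α → Bool := fun c h => decide (h ∈ c)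
  let P (n : ℕ) : ProbabilityMeasure (α → Bool) :=
    ⟨(μ n).map e, Measure.isProbabilityMeasure_map he.aemeasurable⟩
  let U : Ultrafilter ℕ := Filter.hyperfilter ℕ
  obtain ⟨ρ, -, hρ⟩ := isCompact_univ.ultrafilter_le_nhds (U.map P) (by simp)
  let := TopologicalSpace.metrizableSpaceMetric (α → Bool)
  refine ⟨(ρ : Measure (α → Bool)).map fun x => {h | x h = true},
    Measure.isProbabilityMeasure_map measurable_setOf_bool.aemeasurable,
    iSup_measure_gen_of_finite fun 𝓕 h𝓕 => ?_⟩
  have hclopen : IsClopen ((fun x : α → Bool => {h | x h = true}) ⁻¹' gen 𝓕) := by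
    rw [gen_eq_iUnion, Set.preimage_iUnion₂]
    exact h𝓕.isClopen_biUnion fun F _ => isClopen_bool_up F
  have hlim := (ProbabilityMeasure.tendsto_measure_of_isClopen_of_tendsto
    (show Filter.Tendsto P U (𝓝 ρ) from hρ) hclopen)
  have hlim' := (ENNReal.continuous_coe.tendsto _).comp hlim
  rw [ProbabilityMeasure.ennreal_coeFn_eq_coeFn_toMeasure] at hlim'
  rw [Measure.map_apply measurable_setOf_bool (measurableSet_gen 𝓕)]
  refine tendsto_nhds_unique (tendsto_atTop_iSup (hmono 𝓕) |>.mono_left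
    (Nat.hyperfilter_le_atTop)) (hlim'.congr fun n => ?_)
  simp only [Function.comp, ProbabilityMeasure.ennreal_coeFn_eq_coeFn_toMeasure]
  change (μ n).map e _ = _
  rw [Measure.map_apply he (measurable_setOf_bool (measurableSet_gen 𝓕)), ← Set.preimage_comp]
  congr 1
  ext c
  simp

theorem scottSup_spec [Countable α] (μ : ℕ → Measure (Set α)) [∀ n, IsProbabilityMeasure (μ n)]
    (hmono : ∀ Q : Set α → ℝ≥0∞, OmegaCont Q → Monotone fun n => ∫⁻ c, Q c ∂μ n) :
    IsProbabilityMeasure (scottSup (Set.range μ)) ∧ ScottLim μ (scottSup (Set.range μ)) := by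
  have hgen (𝓕 : Set (Finset α)) : Monotone fun n => μ n (gen 𝓕) := by
    simpa [lintegral_indicator (measurableSet_gen 𝓕)] using hmono _ (omegaCont_indicator_gen 𝓕)
  obtain ⟨ν, hν, hlim⟩ := exists_limit μ hgen
  have hsup : IsScottSup (Set.range μ) ν := by
    refine ⟨hν, ?_, fun ρ _ hle B hB => ?_⟩
    · rintro _ ⟨n, rfl⟩ B hB
      obtain ⟨𝓕, rfl⟩ := exists_eq_gen_of_isOpen hB
      exact (le_iSup (fun n => μ n (gen 𝓕)) n).trans_eq (hlim 𝓕)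
    · obtain ⟨𝓕, rfl⟩ := exists_eq_gen_of_isOpen hB
      rw [← hlim]
      exact iSup_le fun n => hle _ ⟨n, rfl⟩ _ hB
  -- `scottSup` chooses some supremum, not necessarily `ν`; leastness of both forces agreement on
  -- Scott-open sets, which is all that `ScottLim.of_gen` needs.
  have hex : ∃ ν, IsScottSup (Set.range μ) ν := ⟨ν, hsup⟩
  have hs : IsScottSup (Set.range μ) (scottSup (Set.range μ)) := by
    rw [scottSup, dif_pos hex]
    exact hex.choose_spec
  have := hs.isProbabilityMeasure
  refine ⟨this, ScottLim.of_gen fun 𝓕 => ⟨hgen 𝓕, (hlim 𝓕).trans (le_antisymm ?_ ?_)⟩⟩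
  · exact hsup.least _ this hs.upper _ (isOpen_gen 𝓕)
  · exact hs.least _ hν hsup.upper _ (isOpen_gen 𝓕)

theorem iSup_diag {f : ℕ → ℕ → ℝ≥0∞} (h₁ : ∀ m, Monotone fun n => f n m)
    (h₂ : ∀ n, Monotone (f n)) : ⨆ n, f n n = ⨆ n, ⨆ m, f n m :=
  le_antisymm (iSup_le fun n => le_iSup₂_of_le n n le_rfl) <| iSup₂_le fun n m =>
    le_iSup_of_le (max n m) ((h₁ m (le_max_left n m)).trans (h₂ _ (le_max_right n m)))

/-- Iterated limits of a doubly increasing family of measures can be interchanged, and agree with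
the limit along the diagonal. -/
theorem ScottLim.interchange {μ : ℕ → ℕ → Measure (Set α)} {ρ σ : ℕ → Measure (Set α)}
    {ν : Measure (Set α)} (h₁ : ∀ m, ScottLim (fun n => μ n m) (ρ m))
    (h₂ : ∀ n, ScottLim (μ n) (σ n)) (h : ScottLim ρ ν) :
    ScottLim σ ν ∧ ScottLim (fun n => μ n n) ν := by
  have hσ : ScottLim σ ν := by
    intro Q hQ
    simp only [← (h₂ _ Q hQ).2]
    refine ⟨fun n n' hn => iSup_mono fun m => (h₁ m Q hQ).1 hn, ?_⟩
    rw [iSup_comm, ← (h Q hQ).2]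
    exact iSup_congr fun m => (h₁ m Q hQ).2
  refine ⟨hσ, fun Q hQ => ⟨fun n n' hn => ((h₁ n Q hQ).1 hn).trans ((h₂ n' Q hQ).1 hn), ?_⟩⟩
  rw [iSup_diag (fun m => (h₁ m Q hQ).1) (fun n => (h₂ n Q hQ).1), ← (hσ Q hQ).2]
  exact iSup_congr fun n => (h₂ n Q hQ).2

theorem OmegaCont.comp_union {Q : Set α → ℝ≥0∞} (hQ : OmegaCont Q) (a : Set α) :
    OmegaCont fun c => Q (a ∪ c) := by
  refine ⟨fun b c h => hQ.mono (Set.union_subset_union_right a h), fun s hs => ?_⟩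
  rw [Set.union_iUnion]
  exact hQ.map_iUnion _ fun m n hmn => Set.union_subset_union_right a (hs hmn)

theorem measurable_const_diff (a : Set α) : Measurable fun b : Set α => a \ b := by
  refine measurable_set_iff.2 fun h => ?_
  by_cases hh : h ∈ a
  · simpa [hh] using measurable_set_notMem h
  · simp [hh]

theorem lintegral_choiceK (r : unitInterval) (P R : Set α → Measure (Set α)) (a : Set α)
    (Q : Set α → ℝ≥0∞) :
    ∫⁻ c, Q c ∂choiceK r P R a =
      ENNReal.ofReal r * ∫⁻ c, Q c ∂P a + ENNReal.ofReal (1 - r) * ∫⁻ c, Q c ∂(R a) := by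
  simp [choiceK, lintegral_add_measure]

theorem ScottLim.choiceK (r : unitInterval) {P R : ℕ → Set α → Measure (Set α)}
    {P' R' : Set α → Measure (Set α)} {a : ℕ → Set α} {b : Set α}
    (hP : ScottLim (fun n => P n (a n)) (P' b)) (hR : ScottLim (fun n => R n (a n)) (R' b)) :
    ScottLim (fun n => choiceK r (P n) (R n) (a n)) (ProbNetKAT.choiceK r P' R' b) := by
  intro Q hQ
  simp only [lintegral_choiceK, ← (hP Q hQ).2, ← (hR Q hQ).2, ENNReal.mul_iSup]
  have h₁ : Monotone fun n => ENNReal.ofReal r * ∫⁻ c, Q c ∂P n (a n) :=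
    fun m n hmn => mul_le_mul_right ((hP Q hQ).1 hmn) _
  have h₂ : Monotone fun n => ENNReal.ofReal (1 - r) * ∫⁻ c, Q c ∂(R n (a n)) :=
    fun m n hmn => mul_le_mul_right ((hR Q hQ).1 hmn) _
  exact ⟨h₁.add h₂, (ENNReal.iSup_add_iSup_of_monotone h₁ h₂).symm⟩

/-! ### Scott-continuous kernels -/

/-- Kernels which preserve limits of increasing sequences. -/
structure IsScottKernel (P : Set α → Measure (Set α)) : Prop where
  isProb : ∀ a, IsProbabilityMeasure (P a)
  cont : ∀ s : ℕ → Set α, Monotone s → ScottLim (fun n => P (s n)) (P (⋃ n, s n))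

theorem IsScottKernel.omegaCont {P : Set α → Measure (Set α)} (hP : IsScottKernel P)
    {Q : Set α → ℝ≥0∞} (hQ : OmegaCont Q) : OmegaCont fun a => ∫⁻ c, Q c ∂P a := by
  refine ⟨fun a b hab => ?_, fun s hs => ((hP.cont s hs Q hQ).2).symm⟩
  -- Monotonicity comes from continuity along the sequence `a, b, b, …`.
  let s : ℕ → Set α := fun n => if n = 0 then a else b
  have hs : Monotone s := monotone_nat_of_le_succ fun n => by
    by_cases hn : n = 0 <;> simp [s, hn, hab]
  simpa [s] using (hP.cont s hs Q hQ).1 zero_le_one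

theorem eq_generateFrom_up :
    (Set.instMeasurableSpace : MeasurableSpace (Set α)) =
      MeasurableSpace.generateFrom (Set.range fun F : Finset α => {c : Set α | (F : Set α) ⊆ c}) := by
  apply le_antisymm
  · let m := MeasurableSpace.generateFrom
      (Set.range fun F : Finset α => {c : Set α | (F : Set α) ⊆ c})
    have hid : @Measurable (Set α) (Set α) m Set.instMeasurableSpace id := by
      refine (@measurable_set_iff α (Set α) m id).2 fun h => ?_
      refine (@measurableSet_setOfPred (Set α) m _).1 ?_
      exact MeasurableSpace.measurableSet_generateFrom ⟨{h}, by simp⟩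
    exact fun s hs => hid hs
  · refine MeasurableSpace.generateFrom_le ?_
    rintro _ ⟨F, rfl⟩
    exact measurableSet_up F

theorem isPiSystem_up :
    IsPiSystem (Set.range fun F : Finset α => {c : Set α | (F : Set α) ⊆ c}) := by
  classical
  rintro _ ⟨F, rfl⟩ _ ⟨G, rfl⟩ -
  refine ⟨F ∪ G, ?_⟩
  ext c
  simp

/-- The up-sets of finite sets form a generating π-system, and the kernel evaluated on each of them
is ω-continuous. -/
theorem IsScottKernel.measurable [Countable α] {P : Set α → Measure (Set α)}
    (hP : IsScottKernel P) : Measurable P := by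
  have := hP.isProb
  refine Measurable.measure_of_isPiSystem_of_isProbabilityMeasure eq_generateFrom_up
    isPiSystem_up ?_
  rintro _ ⟨F, rfl⟩
  simpa [lintegral_indicator (measurableSet_gen _), ← gen_singleton] using
    (hP.omegaCont (omegaCont_indicator_gen {F})).measurable

theorem IsScottKernel.choiceK (r : unitInterval) {P R : Set α → Measure (Set α)}
    (hP : IsScottKernel P) (hR : IsScottKernel R) : IsScottKernel (choiceK r P R) := by
  refine ⟨fun a => ⟨?_⟩, fun s hs => (hP.cont s hs).choiceK r (P := fun _ => P)
    (R := fun _ => R) (hR.cont s hs)⟩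
  have := hP.isProb a
  have := hR.isProb a
  simp only [ProbNetKAT.choiceK, Measure.add_apply, Measure.smul_apply, measure_univ,
    smul_eq_mul, mul_one]
  rw [← ENNReal.ofReal_add r.2.1 (sub_nonneg.2 r.2.2)]
  simp

variable [Countable α]

theorem lintegral_bind_kernel (μ : Measure (Set α)) {P : Set α → Measure (Set α)}
    (hP : IsScottKernel P) {Q : Set α → ℝ≥0∞} (hQ : OmegaCont Q) :
    ∫⁻ c, Q c ∂μ.bind P = ∫⁻ a, ∫⁻ c, Q c ∂P a ∂μ :=
  Measure.lintegral_bind hP.measurable.aemeasurable hQ.measurable.aemeasurable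

theorem isProbabilityMeasure_bind_kernel (μ : Measure (Set α)) [IsProbabilityMeasure μ]
    {P : Set α → Measure (Set α)} (hP : IsScottKernel P) : IsProbabilityMeasure (μ.bind P) :=
  isProbabilityMeasure_bind hP.measurable.aemeasurable (.of_forall hP.isProb)

theorem ScottLim.bind {μ : ℕ → Measure (Set α)} {ν : Measure (Set α)}
    {P : ℕ → Set α → Measure (Set α)} {R : Set α → Measure (Set α)} (hμ : ScottLim μ ν)
    (hP : ∀ n, IsScottKernel (P n)) (hR : IsScottKernel R)
    (h : ∀ a, ScottLim (fun n => P n a) (R a)) :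
    ScottLim (fun n => (μ n).bind (P n)) (ν.bind R) := by
  intro Q hQ
  simp only [lintegral_bind_kernel _ (hP _) hQ, lintegral_bind_kernel _ hR hQ]
  have h₁ m := hμ _ ((hP m).omegaCont hQ)
  have h₂ n : Monotone fun m => ∫⁻ a, ∫⁻ c, Q c ∂P m a ∂μ n :=
    fun m m' hm => lintegral_mono fun a => (h a Q hQ).1 hm
  refine ⟨fun n n' hn => ((h₁ n).1 hn).trans (h₂ n' hn), ?_⟩
  -- The measure and the kernel get separate indices: the supremum over measures uses `hμ` with the
  -- kernel fixed, the one over kernels is monotone convergence under `ν`.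
  rw [iSup_diag (fun m => (h₁ m).1) h₂, iSup_comm]
  simp only [fun m => (h₁ m).2]
  rw [← lintegral_iSup (fun m => ((hP m).omegaCont hQ).measurable)
    fun m m' hm a => (h a Q hQ).1 hm]
  exact lintegral_congr fun a => (h a Q hQ).2

theorem ScottLim.dirac {s : ℕ → Set α} (hs : Monotone s) :
    ScottLim (fun n => Measure.dirac (s n)) (Measure.dirac (⋃ n, s n)) := by
  intro Q hQ
  simp only [lintegral_dirac' _ hQ.measurable]
  exact ⟨hQ.mono.comp hs, (hQ.map_iUnion s hs).symm⟩

theorem isScottKernel_dirac {f : Set α → Set α} (hf : Monotone f)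
    (h : ∀ s : ℕ → Set α, Monotone s → f (⋃ n, s n) = ⋃ n, f (s n)) :
    IsScottKernel fun a => Measure.dirac (f a) := by
  refine ⟨fun a => inferInstance, fun s hs => ?_⟩
  rw [h s hs]
  exact ScottLim.dirac (hf.comp hs)

theorem isScottKernel_dirac_id : IsScottKernel fun a : Set α => Measure.dirac a :=
  isScottKernel_dirac monotone_id fun _ _ => rfl

theorem isScottKernel_dirac_union (b : Set α) : IsScottKernel fun a => Measure.dirac (b ∪ a) :=
  isScottKernel_dirac (fun _ _ h => Set.union_subset_union_right b h)
    fun _ _ => Set.union_iUnion b _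

/-- The law of `b ∪ c` where `c` is distributed according to `ν`. -/
noncomputable def unionK (ν : Measure (Set α)) (b : Set α) : Measure (Set α) :=
  ν.bind fun c => Measure.dirac (b ∪ c)

theorem ScottLim.unionK {μ : ℕ → Measure (Set α)} {ν : Measure (Set α)} (h : ScottLim μ ν)
    {s : ℕ → Set α} (hs : Monotone s) :
    ScottLim (fun n => unionK (μ n) (s n)) (ProbNetKAT.unionK ν (⋃ n, s n)) := by
  refine h.bind (fun n => isScottKernel_dirac_union _) (isScottKernel_dirac_union _) fun a => ?_
  rw [Set.iUnion_union]
  exact ScottLim.dirac fun m n hmn => Set.union_subset_union_left a (hs hmn)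

theorem isScottKernel_unionK (ν : Measure (Set α)) [IsProbabilityMeasure ν] :
    IsScottKernel (unionK ν) :=
  ⟨fun b => isProbabilityMeasure_bind_kernel ν (isScottKernel_dirac_union b),
    fun _ hs => (ScottLim.const ν).unionK hs⟩

/-- Parallel composition is the bind of `P a` with the kernel `unionK (R a)`, so this reduces to
`ScottLim.bind`. -/
theorem ScottLim.parK {P R : ℕ → Set α → Measure (Set α)} {P' R' : Set α → Measure (Set α)}
    {a : ℕ → Set α} {b : Set α} (hP : ScottLim (fun n => P n (a n)) (P' b))
    (hR : ScottLim (fun n => R n (a n)) (R' b)) (hR₁ : ∀ n, IsScottKernel (R n))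
    (hR₂ : IsScottKernel R') :
    ScottLim (fun n => parK (P n) (R n) (a n)) (ProbNetKAT.parK P' R' b) := by
  have h₁ n := (hR₁ n).isProb (a n)
  have h₂ := hR₂.isProb b
  refine hP.bind (fun n => isScottKernel_unionK (R n (a n))) (isScottKernel_unionK (R' b))
    fun c => ?_
  have := hR.unionK (s := fun _ => c) monotone_const
  rwa [Set.iUnion_const] at this

theorem IsScottKernel.parK {P R : Set α → Measure (Set α)} (hP : IsScottKernel P)
    (hR : IsScottKernel R) : IsScottKernel (parK P R) := by
  refine ⟨fun a => ?_, fun s hs => (hP.cont s hs).parK (P := fun _ => P) (R := fun _ => R)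
    (hR.cont s hs) (fun _ => hR) hR⟩
  have := hP.isProb a
  have := hR.isProb a
  exact isProbabilityMeasure_bind_kernel _ (isScottKernel_unionK (R a))

theorem IsScottKernel.seqK {P R : Set α → Measure (Set α)} (hP : IsScottKernel P)
    (hR : IsScottKernel R) : IsScottKernel (seqK P R) := by
  refine ⟨fun a => ?_, fun s hs => (hP.cont s hs).bind (fun _ => hR) hR
    fun a => ScottLim.const (R a)⟩
  have := hP.isProb a
  exact isProbabilityMeasure_bind_kernel _ hR

/-! ### Iteration -/

theorem IsScottKernel.iterK {P : Set α → Measure (Set α)} (hP : IsScottKernel P) (m : ℕ) :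
    IsScottKernel (iterK P m) := by
  induction m with
  | zero => exact isScottKernel_dirac_id
  | succ m ih => exact isScottKernel_dirac_id.parK (hP.seqK ih)

theorem ScottLim.iterK {P : ℕ → Set α → Measure (Set α)} {R : Set α → Measure (Set α)}
    (hP : ∀ n, IsScottKernel (P n)) (hR : IsScottKernel R)
    (h : ∀ a, ScottLim (fun n => P n a) (R a)) (m : ℕ) (a : Set α) :
    ScottLim (fun n => iterK (P n) m a) (ProbNetKAT.iterK R m a) := by
  induction m generalizing a with
  | zero => exact ScottLim.const _
  | succ m ih =>
    exact ScottLim.parK (P := fun _ a => Measure.dirac a) (R := fun n => seqK (P n) _)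
      (a := fun _ => a) (ScottLim.const _)
      ((h a).bind (fun n => (hP n).iterK m) (hR.iterK m) ih)
      (fun n => (hP n).seqK ((hP n).iterK m)) (hR.seqK (hR.iterK m))

theorem lintegral_parK_dirac {R : Set α → Measure (Set α)} (hR : IsScottKernel R) (a : Set α)
    {Q : Set α → ℝ≥0∞} (hQ : OmegaCont Q) :
    ∫⁻ c, Q c ∂parK (fun a => Measure.dirac a) R a = ∫⁻ c, Q (a ∪ c) ∂(R a) := by
  have := hR.isProb a
  change ∫⁻ c, Q c ∂(Measure.dirac a).bind (unionK (R a)) = _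
  rw [Measure.dirac_bind (isScottKernel_unionK (R a)).measurable, unionK,
    lintegral_bind_kernel _ (isScottKernel_dirac_union a) hQ]
  exact lintegral_congr fun c => lintegral_dirac' _ hQ.measurable

theorem monotone_lintegral_iterK {P : Set α → Measure (Set α)} (hP : IsScottKernel P)
    {Q : Set α → ℝ≥0∞} (hQ : OmegaCont Q) (a : Set α) :
    Monotone fun m => ∫⁻ c, Q c ∂iterK P m a := by
  refine monotone_nat_of_le_succ fun m => ?_
  -- Unfolding one iteration replaces `Q` by `c ↦ Q (a ∪ c)` and restarts from a random input `b`,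
  -- hence the generalization.
  induction m generalizing Q a with
  | zero =>
    have hk := hP.seqK (hP.iterK 0)
    have := hk.isProb a
    change _ ≤ ∫⁻ c, Q c ∂parK (fun a => Measure.dirac a) (seqK P (iterK P 0)) a
    rw [lintegral_parK_dirac hk a hQ]
    calc
      ∫⁻ c, Q c ∂iterK P 0 a = ∫⁻ _, Q a ∂seqK P (iterK P 0) a := by
        rw [lintegral_const, measure_univ, mul_one]
        exact lintegral_dirac' _ hQ.measurable
      _ ≤ _ := lintegral_mono fun c => hQ.mono Set.subset_union_left
  | succ m ih =>
    change ∫⁻ c, Q c ∂parK (fun a => Measure.dirac a) (seqK P (iterK P m)) a ≤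
      ∫⁻ c, Q c ∂parK (fun a => Measure.dirac a) (seqK P (iterK P (m + 1))) a
    have hQa := hQ.comp_union a
    rw [lintegral_parK_dirac (hP.seqK (hP.iterK m)) a hQ,
      lintegral_parK_dirac (hP.seqK (hP.iterK (m + 1))) a hQ]
    unfold seqK
    rw [lintegral_bind_kernel _ (hP.iterK m) hQa,
      lintegral_bind_kernel _ (hP.iterK (m + 1)) hQa]
    exact lintegral_mono fun b => ih hQa b

theorem starK_spec {P : Set α → Measure (Set α)} (hP : IsScottKernel P) (a : Set α) :
    IsProbabilityMeasure (starK P a) ∧ ScottLim (fun m => iterK P m a) (starK P a) := by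
  have h m := (hP.iterK m).isProb a
  exact scottSup_spec (fun m => iterK P m a) fun Q hQ => monotone_lintegral_iterK hP hQ a

theorem IsScottKernel.starK {P : Set α → Measure (Set α)} (hP : IsScottKernel P) :
    IsScottKernel (starK P) :=
  ⟨fun a => (starK_spec hP a).1, fun s hs =>
    (ScottLim.interchange (fun m => (hP.iterK m).cont s hs) (fun n => (starK_spec hP (s n)).2)
      (starK_spec hP _).2).1⟩

theorem ScottLim.iterK_starK {P : ℕ → Set α → Measure (Set α)} {R : Set α → Measure (Set α)}
    (hP : ∀ n, IsScottKernel (P n)) (hR : IsScottKernel R)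
    (h : ∀ a, ScottLim (fun n => P n a) (R a)) (a : Set α) :
    ScottLim (fun n => ProbNetKAT.iterK (P n) n a) (starK R a) :=
  (ScottLim.interchange (fun m => ScottLim.iterK hP hR h m a)
    (fun n => (starK_spec (hP n) a).2) (starK_spec hR a).2).2

/-! ### Predicates and programs -/

theorem isScottKernel_dirac_inter (S : Set α) : IsScottKernel fun a => Measure.dirac (a ∩ S) :=
  isScottKernel_dirac (fun _ _ h => Set.inter_subset_inter_left S h)
    fun _ _ => Set.iUnion_inter S _

theorem isScottKernel_dirac_image (f : α → α) : IsScottKernel fun a => Measure.dirac (f '' a) :=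
  isScottKernel_dirac (fun _ _ h => Set.image_mono h) fun _ _ => Set.image_iUnion

variable {k : ℕ} {bound : Fin k → ℕ}

instance : Countable (History bound) :=
  Function.Injective.countable (f := fun h : History bound => (h.head, h.tail)) fun a b h => by
    rw [Prod.mk.injEq] at h
    exact History.ext h.1 h.2

/-- Predicates act as deterministic filters. -/
theorem Pred.exists_den_eq (t : Pred bound) :
    ∃ S : Set (History bound), t.den = fun a => Measure.dirac (a ∩ S) := by
  induction t with
  | drop => exact ⟨∅, by simp [Pred.den]⟩
  | skip => exact ⟨Set.univ, by simp [Pred.den]⟩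
  | test f n => exact ⟨{h | h.head f = n}, rfl⟩
  | disj t u ht hu =>
    obtain ⟨S, hS⟩ := ht
    obtain ⟨T, hT⟩ := hu
    refine ⟨S ∪ T, funext fun a => ?_⟩
    rw [Pred.den, hS, hT]
    change (Measure.dirac (a ∩ S)).bind (unionK (Measure.dirac (a ∩ T))) = _
    rw [Measure.dirac_bind (isScottKernel_unionK _).measurable, unionK,
      Measure.dirac_bind (isScottKernel_dirac_union _).measurable, Set.inter_union_distrib_left]
  | conj t u ht hu =>
    obtain ⟨S, hS⟩ := ht
    obtain ⟨T, hT⟩ := hu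
    refine ⟨S ∩ T, funext fun a => ?_⟩
    rw [Pred.den, hS, hT, seqK, Measure.dirac_bind (isScottKernel_dirac_inter T).measurable,
      Set.inter_assoc]
  | neg t ht =>
    obtain ⟨S, hS⟩ := ht
    refine ⟨Sᶜ, funext fun a => ?_⟩
    -- The map `b ↦ a \ b` is antitone, so it gives no Scott kernel in `b`; measurability is checked
    -- directly, and monotonicity in `a` returns once the negation is seen as the filter `Sᶜ`.
    have hm : Measurable fun b : Set (History bound) => Measure.dirac (a \ b) :=
      Measure.measurable_dirac.comp (measurable_const_diff a)
    rw [Pred.den, hS]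
    change (Measure.dirac (a ∩ S)).bind _ = _
    rw [Measure.dirac_bind hm, Set.sdiff_self_inter, Set.sdiff_eq]

theorem Prog.isScottKernel_den (p : Prog bound) : IsScottKernel p.den := by
  induction p with
  | filter t =>
    obtain ⟨S, hS⟩ := t.exists_den_eq
    rw [Prog.den, hS]
    exact isScottKernel_dirac_inter S
  | modify f n => exact isScottKernel_dirac_image _
  | dup => exact isScottKernel_dirac_image _
  | par p q hp hq => exact hp.parK hq
  | seq p q hp hq => exact hp.seqK hq
  | choice r p q hp hq => exact hp.choiceK r hq
  | star p hp => exact hp.starK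

theorem Prog.scottLim_approx (p : Prog bound) (a : Set (History bound)) :
    ScottLim (fun n => (p.approx n).den a) (p.den a) := by
  induction p generalizing a with
  | filter t => exact ScottLim.const _
  | modify f n => exact ScottLim.const _
  | dup => exact ScottLim.const _
  | par p q hp hq =>
    exact ScottLim.parK (a := fun _ => a) (hp a) (hq a)
      (fun n => (q.approx n).isScottKernel_den) q.isScottKernel_den
  | seq p q hp hq =>
    exact (hp a).bind (fun n => (q.approx n).isScottKernel_den) q.isScottKernel_den hq
  | choice r p q hp hq => exact ScottLim.choiceK r (a := fun _ => a) (hp a) (hq a)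
  | star p hp =>
    simp only [Prog.approx, Prog.den_iter]
    exact ScottLim.iterK_starK (fun n => (p.approx n).isScottKernel_den) p.isScottKernel_den hp a

end ProbNetKAT

theorem mainTheorem11 {k : ℕ} {bound : Fin k → ℕ}
    (μ : MeasureTheory.Measure (Set (ProbNetKAT.History bound)))
    (hμ : MeasureTheory.IsProbabilityMeasure μ)
    (p : ProbNetKAT.Prog bound)
    (Q : Set (ProbNetKAT.History bound) → ENNReal) (hQ : ScottContinuous Q) :
    MeasureTheory.IsProbabilityMeasure (μ.bind p.den) ∧
    (∀ n : ℕ, MeasureTheory.IsProbabilityMeasure (μ.bind (p.approx n).den)) ∧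
    Monotone (fun n : ℕ => ∫⁻ c, Q c ∂(μ.bind (p.approx n).den)) ∧
    ⨆ n : ℕ, ∫⁻ c, Q c ∂(μ.bind (p.approx n).den) = ∫⁻ c, Q c ∂(μ.bind p.den) :=
  ⟨ProbNetKAT.isProbabilityMeasure_bind_kernel μ p.isScottKernel_den,
    fun n => ProbNetKAT.isProbabilityMeasure_bind_kernel μ (p.approx n).isScottKernel_den,
    (ProbNetKAT.ScottLim.const μ).bind (fun n => (p.approx n).isScottKernel_den)
      p.isScottKernel_den p.scottLim_approx Q (ProbNetKAT.OmegaCont.of_scottContinuous hQ)⟩
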